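/- Let $L$ be a countable first-order signature and let $\mathrm{Mod}(L)$ be the set of all $L$-structures with universe $\mathbb N$, on which $\mathrm{Sym}(\mathbb N)$, with the topology of pointwise convergence, acts by permuting the universe (the logic action). A fragment $F$ is a countable set of formulas of the infinitary logic $L_{\omega_1\omega}$ that contains all atomic formulas and is closed under finitary connectives, quantifiers, subformulas, and substitution of terms for variables. Let $t_F$ be the topology on $\mathrm{Mod}(L)$ generated by the sets $\{M : M\models\phi(\bar a)\}$, where $\phi\in F$ and $\bar a\in\mathbb N^{<\mathbb N}$. For $M\in\mathrm{Mod}(L)$ let $[M]$ be the set of all $N\in\mathrm{Mod}(L)$ isomorphic to $M$. For $M\in \mathrm{Mod}(L)$ and $\bar a\in\mathbb N^{<\mathbb N}$ let $\mathrm{tp}^0(\bar a)$ be the $F$-type of $\bar a$ in $M$ (the set of all $\phi(x_1,\dots,x_n)\in F$, $n=|\bar a|$, with $M\models\phi(\bar a)$), and for an ordinal $\alpha>0$ let $$\mathrm{tp}^\alpha(\bar a)=\{\mathrm{tp}^\beta(\bar b):\beta<\alpha,\ \bar b\in\mathbb N^{<\mathbb N}\text{ extends }\bar a\}.$$ In forming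 these iterated sets, $F$-types (together with their arity) are treated as base objects. Put $\mathrm{Th}^\alpha_F(M)=\mathrm{tp}^\alpha(\emptyset)$. For an action of a topological group $G$ on a topological space $X$, $x,y\in X$ and $\alpha<\omega_1$, consider the following game $\mathrm{Appr}_\alpha(x,y)$ between Odd and Eve. Set $x_0=x$, $y_0=y$, $V^y_0=G$, $U^y_0=X$, $\alpha_0=\alpha$. In turn $2n+1$ ($n\ge 0$), Odd either sets $V^x_n=V^y_n$ and $\alpha_{2n+1}=\alpha_{2n}$, or plays a new open neighborhood $V^x_n$ of $1$ in $G$ and an ordinal $\alpha_{2n+1}<\alpha_{2n}$; then he plays an open neighborhood $U^x_n$ of $x_n$. Eve replies with $g^y_n\in G$, and $y_{n+1}=g^y_n.y_n$. In turn $2n+2$, Odd either sets $V^y_{n+1}=V^x_n$ and $\alpha_{2n+2}=\alpha_{2n+1}$, or plays a new open neighborhood $V^y_{n+1}$ of $1$ and an ordinal $\alpha_{2n+2}<\alpha_{2n+1}$; then he plays an open neighborhood $U^y_{n+1}$ of $y_{n+1}$. Eve replies with $g^x_n\in G$, and $x_{n+1}=g^x_n.x_n$. Eve wins if for every $n\ge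 0$: - $y_{n+1}\in\overline{U^x_n}$ and $x_n\in\overline{U^y_n}$; - $g^y_n=h_k\cdots h_0$ for some $k\ge 0$ and $h_0,\dots,h_k\in V^y_n$ with $h_i\cdots h_0.y_n\in U^y_n$ for all $i\le k$; - $g^x_n=h_k\cdots h_0$ for some $k\ge 0$ and $h_0,\dots,h_k\in V^x_n$ with $h_i\cdots h_0.x_n\in U^x_n$ for all $i\le k$. Write $x\sim_\alpha y$ if Eve has a winning strategy in $\mathrm{Appr}_\alpha(x,y)$. Let $\sim_{\alpha,F}$ be the relation $\sim_\alpha$ for the logic action of $\mathrm{Sym}(\mathbb N)$ on $(\mathrm{Mod}(L),t_F)$, and let $[M]_{\alpha,F}=\{N\in \mathrm{Mod}(L): M\sim_{\alpha,F}N\}$. Then for every fragment $F$ in $L$, every $M\in\mathrm{Mod}(L)$ and every $\alpha<\omega_1$: 1. $[M]_{\alpha,F}=\{N\in\mathrm{Mod}(L):\mathrm{Th}^\alpha_F(N)=\mathrm{Th}^\alpha_F(M)\}$; 2. if $\alpha\ge 1$ and $[M]$ is a $\boldsymbol\Pi^0_{1+\alpha}$ subset of $(\mathrm{Mod}(L),t_F)$,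 then $[M]=[M]_{\alpha,F}$. -/

import Mathlib

universe u v w

/-! ### Infinitary formulas and their interpretation in structures with universe `ℕ` -/

/-- Formulas of the infinitary logic `L_{ω₁ω}` with free variables among `x₀, …, x_{n-1}`.
In `ex φ` and `all φ` the quantified variable is the last one, `x_n`. -/
inductive InfFormula (L : FirstOrder.Language.{u, v}) : ℕ → Type (max u v)
  | falsum {n : ℕ} : InfFormula L n
  | equal {n : ℕ} (s t : L.Term (Fin n)) : InfFormula L n
  | rel {n k : ℕ} (R : L.Relations k) (ts : Fin k → L.Term (Fin n)) : InfFormula L n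
  | neg {n : ℕ} (φ : InfFormula L n) : InfFormula L n
  | or {n : ℕ} (φ ψ : InfFormula L n) : InfFormula L n
  | and {n : ℕ} (φ ψ : InfFormula L n) : InfFormula L n
  | ex {n : ℕ} (φ : InfFormula L (n + 1)) : InfFormula L n
  | all {n : ℕ} (φ : InfFormula L (n + 1)) : InfFormula L n
  | iOr {n : ℕ} (φ : ℕ → InfFormula L n) : InfFormula L n
  | iAnd {n : ℕ} (φ : ℕ → InfFormula L n) : InfFormula L n

/-- The space `Mod(L)` of all `L`-structures with universe `ℕ`. -/
abbrev CountableMod (L : FirstOrder.Language.{u, v}) : Type (max u v) := L.Structure ℕ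

/-- The value of a term in a structure with universe `ℕ`. -/
def CountableMod.termVal {L : FirstOrder.Language.{u, v}} (M : CountableMod L) {n : ℕ}
    (t : L.Term (Fin n)) (a : Fin n → ℕ) : ℕ :=
  @FirstOrder.Language.Term.realize L ℕ M (Fin n) a t

namespace InfFormula

variable {L : FirstOrder.Language.{u, v}}

/-- `φ.Realize M a` is `M ⊨ φ(a)`. -/
def Realize (M : CountableMod L) : {n : ℕ} → InfFormula L n → (Fin n → ℕ) → Prop
  | _, falsum, _ => False
  | _, equal s t, a => M.termVal s a = M.termVal t a
  | _, rel R ts, a => @FirstOrder.Language.Structure.RelMap L ℕ M _ R (fun i => M.termVal (ts i) a)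
  | _, neg φ, a => ¬ φ.Realize M a
  | _, or φ ψ, a => φ.Realize M a ∨ ψ.Realize M a
  | _, and φ ψ, a => φ.Realize M a ∧ ψ.Realize M a
  | n, ex φ, a => ∃ x : ℕ, φ.Realize M (Fin.snoc (α := fun _ : Fin (n + 1) => ℕ) a x)
  | n, all φ, a => ∀ x : ℕ, φ.Realize M (Fin.snoc (α := fun _ : Fin (n + 1) => ℕ) a x)
  | _, iOr φ, a => ∃ i, (φ i).Realize M a
  | _, iAnd φ, a => ∀ i, (φ i).Realize M a

/-- Extends a substitution of terms for variables under a quantifier: the quantified variable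
is left alone. -/
def liftSubst {n m : ℕ} (σ : Fin n → L.Term (Fin m)) : Fin (n + 1) → L.Term (Fin (m + 1)) :=
  Fin.snoc (α := fun _ : Fin (n + 1) => L.Term (Fin (m + 1)))
    (fun i => (σ i).relabel Fin.castSucc) (FirstOrder.Language.Term.var (Fin.last m))

/-- Capture-avoiding simultaneous substitution of the terms `σ i` for the free variables. -/
def subst : {n : ℕ} → InfFormula L n → {m : ℕ} → (Fin n → L.Term (Fin m)) → InfFormula L m
  | _, falsum, _, _ => falsum
  | _, equal s t, _, σ => equal (s.subst σ) (t.subst σ)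
  | _, rel R ts, _, σ => rel R (fun i => (ts i).subst σ)
  | _, neg φ, _, σ => neg (φ.subst σ)
  | _, or φ ψ, _, σ => or (φ.subst σ) (ψ.subst σ)
  | _, and φ ψ, _, σ => and (φ.subst σ) (ψ.subst σ)
  | _, ex φ, _, σ => ex (φ.subst (liftSubst σ))
  | _, all φ, _, σ => all (φ.subst (liftSubst σ))
  | _, iOr φ, _, σ => iOr (fun i => (φ i).subst σ)
  | _, iAnd φ, _, σ => iAnd (fun i => (φ i).subst σ)

end InfFormula

/-- A fragment: a countable set of formulas that contains the atomic formulas and is closed under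
finitary connectives, quantifiers, subformulas, and substitution of terms for variables. -/
structure LFragment (L : FirstOrder.Language.{u, v}) where
  formulas : (n : ℕ) → Set (InfFormula L n)
  countable : ∀ n, (formulas n).Countable
  falsum_mem : ∀ {n : ℕ}, InfFormula.falsum ∈ formulas n
  equal_mem : ∀ {n : ℕ} (s t : L.Term (Fin n)), InfFormula.equal s t ∈ formulas n
  rel_mem : ∀ {n k : ℕ} (R : L.Relations k) (ts : Fin k → L.Term (Fin n)),
    InfFormula.rel R ts ∈ formulas n
  neg_mem_iff : ∀ {n : ℕ} {φ : InfFormula L n}, φ.neg ∈ formulas n ↔ φ ∈ formulas n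
  or_mem_iff : ∀ {n : ℕ} {φ ψ : InfFormula L n},
    φ.or ψ ∈ formulas n ↔ φ ∈ formulas n ∧ ψ ∈ formulas n
  and_mem_iff : ∀ {n : ℕ} {φ ψ : InfFormula L n},
    φ.and ψ ∈ formulas n ↔ φ ∈ formulas n ∧ ψ ∈ formulas n
  ex_mem_iff : ∀ {n : ℕ} {φ : InfFormula L (n + 1)}, φ.ex ∈ formulas n ↔ φ ∈ formulas (n + 1)
  all_mem_iff : ∀ {n : ℕ} {φ : InfFormula L (n + 1)}, φ.all ∈ formulas n ↔ φ ∈ formulas (n + 1)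
  of_iOr_mem : ∀ {n : ℕ} {φ : ℕ → InfFormula L n},
    InfFormula.iOr φ ∈ formulas n → ∀ i, φ i ∈ formulas n
  of_iAnd_mem : ∀ {n : ℕ} {φ : ℕ → InfFormula L n},
    InfFormula.iAnd φ ∈ formulas n → ∀ i, φ i ∈ formulas n
  subst_mem : ∀ {n m : ℕ} {φ : InfFormula L n} (σ : Fin n → L.Term (Fin m)),
    φ ∈ formulas n → φ.subst σ ∈ formulas m

/-- The topology `t_F` on `Mod(L)`, generated by the sets `[φ(a)] = {M | M ⊨ φ(a)}`, where
`φ ∈ F` and `a` is a finite tuple of natural numbers. -/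
@[reducible] def LFragment.topology {L : FirstOrder.Language.{u, v}} (F : LFragment L) :
    TopologicalSpace (CountableMod L) :=
  TopologicalSpace.generateFrom
    {S | ∃ (n : ℕ) (φ : InfFormula L n) (a : Fin n → ℕ), φ ∈ F.formulas n ∧
      S = {M : CountableMod L | φ.Realize M a}}

/-! ### The logic action and isomorphism -/

/-- The topology of pointwise convergence on `Sym(ℕ)`, where `ℕ` is discrete. -/
@[reducible] def symTopology : TopologicalSpace (Equiv.Perm ℕ) :=
  TopologicalSpace.induced (fun g : Equiv.Perm ℕ => (g : ℕ → ℕ)) inferInstance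

/-- The logic action of `Sym(ℕ)` on `Mod(L)`: `g` is an isomorphism of `M` onto `g • M`. -/
instance CountableMod.instMulAction (L : FirstOrder.Language.{u, v}) :
    MulAction (Equiv.Perm ℕ) (CountableMod L) where
  smul g M := @Equiv.inducedStructure L ℕ ℕ M g
  one_smul _ := rfl
  mul_smul _ _ _ := rfl

/-- The isomorphism class `[M]` in `Mod(L)`. -/
def CountableMod.isoClass {L : FirstOrder.Language.{u, v}} (M : CountableMod L) : Set (CountableMod L) :=
  {N | Nonempty (@FirstOrder.Language.Equiv L ℕ ℕ M N)}

/-! ### Hereditary sets over a collection of base objects -/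

/-- Names for base objects and for sets, sets of sets, …, built from them. -/
inductive PreHSet (A : Type w) : Type (max w 2)
  | base (a : A) : PreHSet A
  | fam (ι : Type 1) (f : ι → PreHSet A) : PreHSet A

namespace PreHSet

variable {A : Type w}

/-- Extensional equality of names: a base object equals only itself, and two sets are
equal if they have the same elements. -/
def Eqv : PreHSet A → PreHSet A → Prop
  | base a, base b => a = b
  | base _, fam _ _ => False
  | fam _ _, base _ => False
  | fam _ f, fam _ g => (∀ i, ∃ j, Eqv (f i) (g j)) ∧ (∀ j, ∃ i, Eqv (f i) (g j))

theorem Eqv.refl : ∀ x : PreHSet A, Eqv x x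
  | base _ => rfl
  | fam _ f => ⟨fun i => ⟨i, Eqv.refl (f i)⟩, fun i => ⟨i, Eqv.refl (f i)⟩⟩

theorem Eqv.symm : ∀ {x y : PreHSet A}, Eqv x y → Eqv y x
  | base _, base _, h => Eq.symm h
  | base _, fam _ _, h => h.elim
  | fam _ _, base _, h => h.elim
  | fam _ _, fam _ _, h =>
    ⟨fun j => (h.2 j).imp fun _ hi => Eqv.symm hi, fun i => (h.1 i).imp fun _ hj => Eqv.symm hj⟩

theorem Eqv.trans : ∀ {x y z : PreHSet A}, Eqv x y → Eqv y z → Eqv x z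
  | base _, base _, base _, h, h' => Eq.trans h h'
  | base _, base _, fam _ _, _, h' => h'.elim
  | base _, fam _ _, _, h, _ => h.elim
  | fam _ _, base _, _, h, _ => h.elim
  | fam _ _, fam _ _, base _, _, h' => h'.elim
  | fam _ _, fam _ _, fam _ _, h, h' =>
    ⟨fun i => let ⟨j, hj⟩ := h.1 i; let ⟨k, hk⟩ := h'.1 j; ⟨k, Eqv.trans hj hk⟩,
     fun k => let ⟨j, hj⟩ := h'.2 k; let ⟨i, hi⟩ := h.2 j; ⟨i, Eqv.trans hi hj⟩⟩

/-- Extensional equality as a setoid. -/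
instance setoid (A : Type w) : Setoid (PreHSet A) where
  r := Eqv
  iseqv := ⟨Eqv.refl, Eqv.symm, Eqv.trans⟩

end PreHSet

/-- Hereditary sets with elements of `A` as urelements. -/
def HSet (A : Type w) : Type (max w 2) := Quotient (PreHSet.setoid A)

namespace HSet

variable {A : Type w}

/-- An element of `A` as a base object. -/
def base (a : A) : HSet A := Quotient.mk _ (PreHSet.base a)

/-- The set `{f i | i : ι}`. -/
noncomputable def setOf {ι : Type 1} (f : ι → HSet A) : HSet A :=
  Quotient.mk _ (PreHSet.fam ι (fun i => (f i).out))

theorem base_inj {a b : A} : base a = base b ↔ a = b :=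
  ⟨fun h => Quotient.exact h, fun h => congrArg base h⟩

theorem base_ne_setOf {a : A} {ι : Type 1} {f : ι → HSet A} : base a ≠ setOf f :=
  fun h => (Quotient.exact h : PreHSet.Eqv (PreHSet.base a) (PreHSet.fam ι _))

/-- Extensionality: two sets are equal exactly if they have the same elements. -/
theorem setOf_eq_iff {ι κ : Type 1} {f : ι → HSet A} {g : κ → HSet A} :
    setOf f = setOf g ↔ Set.range f = Set.range g := by
  have key : ∀ i j, PreHSet.Eqv (f i).out (g j).out ↔ f i = g j := fun i j =>
    ⟨fun h => Quotient.out_equiv_out.1 h, fun h => Quotient.out_equiv_out.2 h⟩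
  constructor
  · intro h
    obtain ⟨h1, h2⟩ := (Quotient.exact h : PreHSet.Eqv (PreHSet.fam ι _) (PreHSet.fam κ _))
    apply Set.Subset.antisymm
    · rintro _ ⟨i, rfl⟩
      obtain ⟨j, hj⟩ := h1 i
      exact ⟨j, ((key i j).1 hj).symm⟩
    · rintro _ ⟨j, rfl⟩
      obtain ⟨i, hi⟩ := h2 j
      exact ⟨i, (key i j).1 hi⟩
  · intro h
    refine Quotient.sound (show PreHSet.Eqv (PreHSet.fam ι _) (PreHSet.fam κ _) from ⟨?_, ?_⟩)
    · intro i
      obtain ⟨j, hj⟩ : f i ∈ Set.range g := h ▸ Set.mem_range_self i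
      exact ⟨j, (key i j).2 hj.symm⟩
    · intro j
      obtain ⟨i, hi⟩ : g j ∈ Set.range f := h ▸ Set.mem_range_self j
      exact ⟨i, (key i j).2 hi⟩

end HSet

/-! ### Iterated types and theories -/

/-- The `F`-type in `M` of the tuple of natural numbers listed by `a`, with its arity. -/
def LFragment.typeOf {L : FirstOrder.Language.{u, v}} (F : LFragment L) (M : CountableMod L) (a : List ℕ) :
    Σ n : ℕ, Set (InfFormula L n) :=
  ⟨a.length, {φ | φ ∈ F.formulas a.length ∧ φ.Realize M a.get}⟩

open Classical in
/-- `tp^0(a)` is the `F`-type of `a`, and, for `α > 0`,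
`tp^α(a) = {tp^β(b) | β < α, b is a finite tuple extending a}`. -/
noncomputable def LFragment.iterType {L : FirstOrder.Language.{u, v}} (F : LFragment L) (M : CountableMod L)
    (α : Ordinal.{0}) (a : List ℕ) : HSet (Σ n : ℕ, Set (InfFormula L n)) :=
  if α = 0 then HSet.base (F.typeOf M a)
  else HSet.setOf (fun p : {p : Ordinal.{0} × List ℕ // p.1 < α ∧ a <+: p.2} =>
    F.iterType M p.1.1 p.1.2)
termination_by α
decreasing_by exact p.2.1

/-- `Th^α_F(M) = tp^α(∅)`. -/
noncomputable def LFragment.iterTheory {L : FirstOrder.Language.{u, v}} (F : LFragment L) (α : Ordinal.{0})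
    (M : CountableMod L) : HSet (Σ n : ℕ, Set (InfFormula L n)) :=
  F.iterType M α []

/-! ### Borel classes -/

/-- `IsBorelSigma α S`: `S` belongs to the additive Borel class `Σ⁰_α`, `α ≥ 1`. The class `Σ⁰_1`
consists of the open sets, and, for `α > 1`, the elements of `Σ⁰_α` are the countable unions of
sets whose complements belong to classes `Σ⁰_β`, `1 ≤ β < α`. -/
inductive IsBorelSigma {X : Type w} [TopologicalSpace X] : Ordinal.{0} → Set X → Prop
  | of_isOpen (S : Set X) : IsOpen S → IsBorelSigma 1 S
  | iUnion (α : Ordinal.{0}) (β : ℕ → Ordinal.{0}) (S : ℕ → Set X) :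
      (∀ n, β n < α) → (∀ n, IsBorelSigma (β n) (S n)ᶜ) → IsBorelSigma α (⋃ n, S n)

/-- `S` belongs to the multiplicative Borel class `Π⁰_α`, `α ≥ 1`. -/
def IsBorelPi {X : Type w} [TopologicalSpace X] (α : Ordinal.{0}) (S : Set X) : Prop :=
  IsBorelSigma α Sᶜ

/-! ### Approximations of the Hjorth-isomorphism game -/

section Game

variable {G : Type v} {X : Type w} [Group G] [MulAction G X]

/-- The product `h_k ⋯ h_0`. -/
def descProd (h : ℕ → G) : ℕ → G
  | 0 => h 0
  | k + 1 => h (k + 1) * descProd h k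

/-- `g = h_k ⋯ h_0` for some `k ≥ 0` and `h_0, …, h_k ∈ V` such that `h_i ⋯ h_0 . z ∈ U` for
`i ≤ k`. -/
def IsLocalMove (V : Set G) (U : Set X) (z : X) (g : G) : Prop :=
  ∃ (k : ℕ) (h : ℕ → G), g = descProd h k ∧ ∀ i ≤ k, h i ∈ V ∧ descProd h i • z ∈ U

/-- A move of Odd: a subset `V` of the group, an ordinal, and an open set `U`. -/
structure OddMove (G : Type v) (X : Type w) where
  V : Set G
  ord : Ordinal.{0}
  U : Set X

/-- The points `y_0, x_0, y_1, x_1, y_2, x_2, …`, in this order, when Eve plays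
`g 0 = g^y_0, g 1 = g^x_0, g 2 = g^y_1, g 3 = g^x_1, …`. -/
def gamePoint (x y : X) (g : ℕ → G) : ℕ → X
  | 0 => y
  | 1 => x
  | t + 2 => g t • gamePoint x y g t

/-- Eve's moves against the moves `o 1, o 2, …` of Odd, when she follows the strategy `s`, a
function of all the moves that Odd has made so far. Eve's reply in turn `t + 1` is `g t`. -/
def strategyMoves (s : List (OddMove G X) → G) (o : ℕ → OddMove G X) (t : ℕ) : G :=
  s (List.ofFn fun i : Fin (t + 1) => o (i + 1))

variable [TopologicalSpace X]

/-- The rules for Odd. Turns are numbered `1, 2, 3, …`, and `o t` is Odd's move in turn `t`;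
`o 0` stands for the initial data `V^y_0 = V`, `α`, `U^y_0 = U`. So `(o 0).V, (o 1).V, (o 2).V, …`
are `V^y_0, V^x_0, V^y_1, V^x_1, …`, and similarly for the sets `U`. In each turn Odd either keeps
the set `V` and the ordinal or plays a new `V ∈ 𝒱` with a smaller ordinal, and then he
plays an open neighborhood of the current point (`x_0, y_1, x_1, y_2, …` in turns
`1, 2, 3, 4, …`). -/
def OddLegal (x y : X) (𝒱 : Set (Set G)) (o : ℕ → OddMove G X) (g : ℕ → G) : Prop :=
  ∀ t : ℕ,
    (((o (t + 1)).V = (o t).V ∧ (o (t + 1)).ord = (o t).ord) ∨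
      ((o (t + 1)).V ∈ 𝒱 ∧ (o (t + 1)).ord < (o t).ord)) ∧
    IsOpen (o (t + 1)).U ∧ gamePoint x y g (t + 1) ∈ (o (t + 1)).U

/-- The winning condition for Eve: `x_n ∈ cl(U^y_n)` and `y_{n+1} ∈ cl(U^x_n)`, and `g^y_n` and
`g^x_n` are local moves for `V^y_n, U^y_n, y_n` and for `V^x_n, U^x_n, x_n`, for all `n ≥ 0`. -/
def EveWins (x y : X) (o : ℕ → OddMove G X) (g : ℕ → G) : Prop :=
  ∀ t : ℕ, gamePoint x y g (t + 1) ∈ closure (o t).U ∧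
    IsLocalMove (o t).V (o t).U (gamePoint x y g t) (g t)

/-- Eve has a winning strategy in the game `Appr_α(x, y, 𝒱, V, U)`. -/
def EveHasWinningStrategy (α : Ordinal.{0}) (x y : X) (𝒱 : Set (Set G)) (V : Set G)
    (U : Set X) : Prop :=
  ∃ s : List (OddMove G X) → G, ∀ o : ℕ → OddMove G X, o 0 = ⟨V, α, U⟩ →
    OddLegal x y 𝒱 o (strategyMoves s o) → EveWins x y o (strategyMoves s o)

/-- The relation `x ∼_α y`: Eve has a winning strategy in `Appr_α(x, y, 𝒱, G, X)`, where `𝒱`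
consists of all open neighborhoods of `1` in `G`. -/
def ApprRel (G : Type v) [Group G] [TopologicalSpace G] [MulAction G X] (α : Ordinal.{0})
    (x y : X) : Prop :=
  EveHasWinningStrategy α x y {V : Set G | IsOpen V ∧ (1 : G) ∈ V} Set.univ Set.univ

end Game

/-- The relation `∼_{α,F}` on `Mod(L)`: the relation `∼_α` for the logic action of `Sym(ℕ)` on
`Mod(L)` with the topology `t_F`. -/
def LFragment.ApprRel {L : FirstOrder.Language.{u, v}} (F : LFragment L) (α : Ordinal.{0})
    (M N : CountableMod L) : Prop :=
  @_root_.ApprRel (CountableMod L) F.topology (Equiv.Perm ℕ) _ symTopology _ α M N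

/-- The class `[M]_{α,F}` of `M` with respect to `∼_{α,F}`. -/
def LFragment.apprClass {L : FirstOrder.Language.{u, v}} (F : LFragment L) (α : Ordinal.{0})
    (M : CountableMod L) : Set (CountableMod L) :=
  {N | F.ApprRel α M N}

/-! Write `stab a` for the permutations fixing the tuple `a`. Part 1 rests on the fact that a
position of the game with `V = stab a` and ordinal `α` is governed by whether `a` has the same
`tp^α` in both structures. If Eve wins, the types agree (`iterType_eq_of_eveHasWinningStrategy`,
induction on `α`). At level `0` Odd plays the clopen set of a formula about `a`. At higher levels he
plays `stab c` with `c` extending `a`, and Eve's reply `g ∈ stab a` turns `c` into the matching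
tuple `g⁻¹c` of the other structure. Conversely, Eve wins by keeping the types of some
repetition-free `a` with `stab a ⊆ V` equal (`GameInvariant.exists_reply`): she takes a tuple `c`
matching a long enough `b` and replies with a permutation that maps `c` to `b`.

Part 2 is a category argument in `Sym(ℕ)`. Whether `g⁻¹ • M` lies in a `Π⁰_{1+β}` set for generic
`g` extending a finite injection `b` depends only on `tp^β(b)` in `M` (`eventually_inv_smul_mem`).
If `[M]` is `Π⁰_{1+α}` and `N` has the same theory as `M`, then `g⁻¹ • N ∈ [M]` for generic `g`,
since this holds for `M` and every `g`. Hence `N ∈ [M]`. -/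

/-! ### Substitution, finite conjunctions, and invariance of truth under isomorphism -/

section Formulas

variable {L : FirstOrder.Language.{u, v}}

theorem CountableMod.termVal_subst (M : CountableMod L) {n m : ℕ} (t : L.Term (Fin n))
    (σ : Fin n → L.Term (Fin m)) (a : Fin m → ℕ) :
    M.termVal (t.subst σ) a = M.termVal t (fun i => M.termVal (σ i) a) := by
  letI := M
  exact FirstOrder.Language.Term.realize_subst

theorem CountableMod.termVal_liftSubst (M : CountableMod L) {n m : ℕ}
    (σ : Fin n → L.Term (Fin m)) (a : Fin m → ℕ) (x : ℕ) :
    (fun i => M.termVal (InfFormula.liftSubst σ i) (Fin.snoc (α := fun _ => ℕ) a x)) =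
      Fin.snoc (α := fun _ => ℕ) (fun i => M.termVal (σ i) a) x := by
  letI := M
  funext i
  refine Fin.lastCases ?_ (fun j => ?_) i
  · simp [InfFormula.liftSubst, CountableMod.termVal]
  · simp only [InfFormula.liftSubst, CountableMod.termVal, Fin.snoc_castSucc,
      FirstOrder.Language.Term.realize_relabel]
    congr 1
    funext k
    simp

/-- The permutation of `ℕ` underlying an isomorphism. -/
def CountableMod.isoPerm {M N : CountableMod L} (e : @FirstOrder.Language.Equiv L ℕ ℕ M N) :
    Equiv.Perm ℕ :=
  @FirstOrder.Language.Equiv.toEquiv L ℕ ℕ M N e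

namespace InfFormula

open CountableMod (isoPerm)

theorem realize_subst (M : CountableMod L) {n : ℕ} (φ : InfFormula L n) {m : ℕ}
    (σ : Fin n → L.Term (Fin m)) (a : Fin m → ℕ) :
    (φ.subst σ).Realize M a ↔ φ.Realize M (fun i => M.termVal (σ i) a) := by
  induction φ generalizing m with
  | falsum => rfl
  | equal s t => simp only [subst, Realize, CountableMod.termVal_subst]
  | rel R ts => simp only [subst, Realize, CountableMod.termVal_subst]
  | neg φ ih => simp only [subst, Realize, ih]
  | or φ ψ ih₁ ih₂ => simp only [subst, Realize, ih₁, ih₂]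
  | and φ ψ ih₁ ih₂ => simp only [subst, Realize, ih₁, ih₂]
  | ex φ ih => simp only [subst, Realize, ih, CountableMod.termVal_liftSubst]
  | all φ ih => simp only [subst, Realize, ih, CountableMod.termVal_liftSubst]
  | iOr φ ih => simp only [subst, Realize, ih]
  | iAnd φ ih => simp only [subst, Realize, ih]

theorem realize_subst_var (M : CountableMod L) {n : ℕ} (φ : InfFormula L n) {m : ℕ}
    (f : Fin n → Fin m) (a : Fin m → ℕ) :
    (φ.subst fun i => FirstOrder.Language.Term.var (f i)).Realize M a ↔ φ.Realize M (a ∘ f) :=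
  realize_subst M φ _ a

/-- The conjunction of a finite list of formulas. -/
def listAnd {n : ℕ} : List (InfFormula L n) → InfFormula L n
  | [] => falsum.neg
  | φ :: l => φ.and (listAnd l)

theorem realize_listAnd (M : CountableMod L) {n : ℕ} (l : List (InfFormula L n)) (a : Fin n → ℕ) :
    (listAnd l).Realize M a ↔ ∀ φ ∈ l, φ.Realize M a := by
  induction l with
  | nil => simp [listAnd, Realize]
  | cons φ l ih => simp [listAnd, Realize, ih]

/-- The formula saying that the variables have pairwise distinct values. -/
def distinct (L : FirstOrder.Language.{u, v}) (n : ℕ) : InfFormula L n :=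
  listAnd ((List.finRange n ×ˢ List.finRange n).map fun p =>
    if p.1 = p.2 then falsum.neg
    else (equal (FirstOrder.Language.Term.var p.1) (FirstOrder.Language.Term.var p.2)).neg)

theorem realize_distinct (M : CountableMod L) {n : ℕ} (a : Fin n → ℕ) :
    (distinct L n).Realize M a ↔ Function.Injective a := by
  simp only [distinct, realize_listAnd, List.mem_map, forall_exists_index, and_imp,
    forall_apply_eq_imp_iff₂]
  constructor
  · intro h i j hij
    by_contra hne
    have := h (i, j) (by simp)
    rw [if_neg hne] at this
    exact this hij
  · rintro h ⟨i, j⟩ -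
    split_ifs with hne
    · exact not_false
    · exact fun hij => hne (h hij)

section Isomorphism

variable {M N : CountableMod L} (e : @FirstOrder.Language.Equiv L ℕ ℕ M N)

theorem _root_.CountableMod.termVal_equiv {n : ℕ} (t : L.Term (Fin n)) (a : Fin n → ℕ) :
    N.termVal t (isoPerm e ∘ a) = isoPerm e (M.termVal t a) :=
  @FirstOrder.Language.HomClass.realize_term L ℕ ℕ M N _ _ _ _ e t a

theorem realize_equiv {n : ℕ} (φ : InfFormula L n) (a : Fin n → ℕ) :
    φ.Realize N (isoPerm e ∘ a) ↔ φ.Realize M a := by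
  have snoc : ∀ {n : ℕ} (a : Fin n → ℕ) (x : ℕ),
      Fin.snoc (α := fun _ => ℕ) (isoPerm e ∘ a)
        (isoPerm e x) =
      isoPerm e ∘ Fin.snoc (α := fun _ => ℕ) a x := by
    intro n a x
    exact (Fin.comp_snoc _ a x).symm
  induction φ with
  | falsum => rfl
  | equal s t =>
    simp only [Realize, CountableMod.termVal_equiv, EmbeddingLike.apply_eq_iff_eq]
  | rel R ts =>
    simp only [Realize, CountableMod.termVal_equiv]
    exact @FirstOrder.Language.Equiv.map_rel L ℕ ℕ M N e _ R _
  | neg φ ih => simp only [Realize, ih]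
  | or φ ψ ih₁ ih₂ => simp only [Realize, ih₁, ih₂]
  | and φ ψ ih₁ ih₂ => simp only [Realize, ih₁, ih₂]
  | ex φ ih =>
    simp only [Realize]
    rw [← (isoPerm e).exists_congr_right]
    simp only [snoc, ih]
  | all φ ih =>
    simp only [Realize]
    rw [← (isoPerm e).forall_congr_right]
    simp only [snoc, ih]
  | iOr φ ih => simp only [Realize, ih]
  | iAnd φ ih => simp only [Realize, ih]

end Isomorphism

end InfFormula

/-- The isomorphism of `M` onto `g • M`. -/
def CountableMod.smulEquiv (g : Equiv.Perm ℕ) (M : CountableMod L) :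
    @FirstOrder.Language.Equiv L ℕ ℕ M (g • M) :=
  @Equiv.inducedStructureEquiv L ℕ ℕ M g

theorem InfFormula.realize_smul (g : Equiv.Perm ℕ) (M : CountableMod L) {n : ℕ}
    (φ : InfFormula L n) (a : Fin n → ℕ) :
    φ.Realize (g • M) (g ∘ a) ↔ φ.Realize M a :=
  realize_equiv (CountableMod.smulEquiv g M) φ a

end Formulas

/-! ### `F`-types, iterated types and their invariance -/

section Types

variable {L : FirstOrder.Language.{u, v}}

open CountableMod (isoPerm)

/-- The first `n` entries of a list of natural numbers, as a tuple. -/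
def List.tuple (a : List ℕ) (n : ℕ) : Fin n → ℕ := fun i => a.getD i 0

theorem List.tuple_length (a : List ℕ) : a.tuple a.length = a.get := by
  funext i
  simp [List.tuple]

theorem List.tuple_snoc {a : List ℕ} {n : ℕ} (h : a.length = n) (x : ℕ) :
    (a ++ [x]).tuple (n + 1) = Fin.snoc (α := fun _ => ℕ) (a.tuple n) x := by
  subst h
  funext i
  refine Fin.lastCases ?_ (fun j => ?_) i
  · simp [List.tuple]
  · simp [List.tuple]

theorem List.tuple_map {a : List ℕ} {n : ℕ} (h : n ≤ a.length) (f : ℕ → ℕ) :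
    (a.map f).tuple n = f ∘ a.tuple n := by
  funext i
  have : (i : ℕ) < a.length := by omega
  simp [List.tuple, this]

theorem List.tuple_injective_iff {a : List ℕ} {n : ℕ} (h : a.length = n) :
    Function.Injective (a.tuple n) ↔ a.Nodup := by
  subst h
  rw [List.tuple_length, List.nodup_iff_injective_get]

theorem List.exists_tuple_comp {m : ℕ} {d : Fin m → ℕ} {b : List ℕ} (h : ∀ i, d i ∈ b) :
    ∃ f : Fin m → Fin b.length, d = b.tuple b.length ∘ f := by
  choose f hf using fun i => List.mem_iff_get.1 (h i)
  exact ⟨f, by rw [List.tuple_length]; funext i; exact (hf i).symm⟩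

namespace LFragment

variable (F : LFragment L)

/-- Keeping the arity `n` apart from `a.length` lets tuples of equal length be compared without
casts between formula types. -/
theorem typeOf_eq (M : CountableMod L) {a : List ℕ} {n : ℕ} (h : a.length = n) :
    F.typeOf M a = ⟨n, {φ | φ ∈ F.formulas n ∧ φ.Realize M (a.tuple n)}⟩ := by
  subst h
  rw [List.tuple_length]
  rfl

variable {F}

theorem length_eq_of_typeOf_eq {M N : CountableMod L} {a b : List ℕ}
    (h : F.typeOf M a = F.typeOf N b) : a.length = b.length :=
  congrArg Sigma.fst h

theorem realize_iff_of_typeOf_eq {M N : CountableMod L} {a b : List ℕ}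
    (h : F.typeOf M a = F.typeOf N b) {n : ℕ} (ha : a.length = n) {φ : InfFormula L n}
    (hφ : φ ∈ F.formulas n) : φ.Realize M (a.tuple n) ↔ φ.Realize N (b.tuple n) := by
  have hb := (length_eq_of_typeOf_eq h).symm.trans ha
  rw [F.typeOf_eq M ha, F.typeOf_eq N hb] at h
  have := Set.ext_iff.1 (eq_of_heq (Sigma.mk.inj h).2) φ
  simpa [hφ] using this

theorem typeOf_eq_of_forall {M N : CountableMod L} {a b : List ℕ} {n : ℕ} (ha : a.length = n)
    (hb : b.length = n)
    (h : ∀ φ ∈ F.formulas n, φ.Realize M (a.tuple n) → φ.Realize N (b.tuple n)) :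
    F.typeOf M a = F.typeOf N b := by
  rw [F.typeOf_eq M ha, F.typeOf_eq N hb]
  congr 1
  ext φ
  refine and_congr_right fun hφ => ⟨h φ hφ, fun h' => ?_⟩
  by_contra hn
  exact h φ.neg (F.neg_mem_iff.2 hφ) hn h'

variable (F)

theorem listAnd_mem {n : ℕ} {l : List (InfFormula L n)} (h : ∀ φ ∈ l, φ ∈ F.formulas n) :
    InfFormula.listAnd l ∈ F.formulas n := by
  induction l with
  | nil => exact F.neg_mem_iff.2 F.falsum_mem
  | cons φ l ih =>
    exact F.and_mem_iff.2 ⟨h φ (by simp), ih fun ψ hψ => h ψ (by simp [hψ])⟩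

theorem distinct_mem (n : ℕ) : InfFormula.distinct L n ∈ F.formulas n := by
  refine F.listAnd_mem fun φ hφ => ?_
  obtain ⟨p, -, rfl⟩ := List.mem_map.1 hφ
  split_ifs
  · exact F.neg_mem_iff.2 F.falsum_mem
  · exact F.neg_mem_iff.2 (F.equal_mem _ _)

variable {F}

theorem nodup_of_typeOf_eq {M N : CountableMod L} {a b : List ℕ}
    (h : F.typeOf M a = F.typeOf N b) (ha : a.Nodup) : b.Nodup := by
  rw [← List.tuple_injective_iff (length_eq_of_typeOf_eq h).symm, ← InfFormula.realize_distinct N,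
    ← realize_iff_of_typeOf_eq h rfl (F.distinct_mem _), InfFormula.realize_distinct,
    List.tuple_injective_iff rfl]
  exact ha

/-- The entries of `l` are quantified away one at a time from the right; `F` is closed under `∃`. -/
theorem exists_extension {M N : CountableMod L} {a b : List ℕ}
    (h : F.typeOf M a = F.typeOf N b) (l : List ℕ) {n : ℕ} (hn : (a ++ l).length = n)
    {φ : InfFormula L n} (hφ : φ ∈ F.formulas n) (hM : φ.Realize M ((a ++ l).tuple n)) :
    ∃ l' : List ℕ, (b ++ l').length = n ∧ φ.Realize N ((b ++ l').tuple n) := by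
  induction l using List.reverseRecOn generalizing n with
  | nil =>
    rw [List.append_nil] at hM hn
    refine ⟨[], ?_, ?_⟩
    · rw [List.append_nil, ← length_eq_of_typeOf_eq h, hn]
    · rw [List.append_nil]
      exact (realize_iff_of_typeOf_eq h hn hφ).1 hM
  | append_singleton l x ih =>
    have hn' : (a ++ l).length + 1 = n := by
      rw [← hn]; simp; omega
    subst hn'
    rw [← List.append_assoc, List.tuple_snoc rfl] at hM
    obtain ⟨l', hl', x', hx'⟩ := ih rfl (F.ex_mem_iff.2 hφ) ⟨x, hM⟩
    refine ⟨l' ++ [x'], ?_, ?_⟩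
    · rw [← List.append_assoc, List.length_append, hl', List.length_singleton]
    · rwa [← List.append_assoc, List.tuple_snoc hl']

/-- Distinctness is expressible in `F`, so it can be conjoined to `φ`. Repetition-free tuples are
what permutations can match. -/
theorem exists_nodup_extension {M N : CountableMod L} {a b c : List ℕ}
    (h : F.typeOf M a = F.typeOf N b) (hac : a <+: c) (hc : c.Nodup) {φ : InfFormula L c.length}
    (hφ : φ ∈ F.formulas c.length) (hM : φ.Realize M (c.tuple c.length)) :
    ∃ d : List ℕ, b <+: d ∧ d.Nodup ∧ d.length = c.length ∧ φ.Realize N (d.tuple c.length) := by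
  obtain ⟨l, rfl⟩ := hac
  obtain ⟨l', hl, hφ', hd⟩ := exists_extension h l rfl
    (F.and_mem_iff.2 ⟨hφ, F.distinct_mem _⟩)
    ⟨hM, (InfFormula.realize_distinct M _).2 ((List.tuple_injective_iff rfl).2 hc)⟩
  exact ⟨b ++ l', List.prefix_append _ _,
    (List.tuple_injective_iff hl).1 ((InfFormula.realize_distinct N _).1 hd), hl, hφ'⟩

variable (F)

theorem typeOf_map {M N : CountableMod L} (e : @FirstOrder.Language.Equiv L ℕ ℕ M N)
    (a : List ℕ) : F.typeOf N (a.map (isoPerm e)) = F.typeOf M a := by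
  refine (typeOf_eq_of_forall rfl (by simp) fun φ _ hφ => ?_).symm
  rwa [List.tuple_map le_rfl, InfFormula.realize_equiv]

theorem iterType_zero (M : CountableMod L) (a : List ℕ) :
    F.iterType M 0 a = HSet.base (F.typeOf M a) := by
  rw [iterType, if_pos rfl]

theorem iterType_of_ne_zero (M : CountableMod L) {α : Ordinal.{0}} (hα : α ≠ 0) (a : List ℕ) :
    F.iterType M α a = HSet.setOf (fun p : {p : Ordinal.{0} × List ℕ // p.1 < α ∧ a <+: p.2} =>
      F.iterType M p.1.1 p.1.2) := by
  rw [iterType, if_neg hα]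

variable {F}

theorem iterType_eq_iff {M N : CountableMod L} {α β : Ordinal.{0}} (hα : α ≠ 0) (hβ : β ≠ 0)
    {a b : List ℕ} : F.iterType M α a = F.iterType N β b ↔
      (∀ γ < α, ∀ c, a <+: c → ∃ δ < β, ∃ d, b <+: d ∧ F.iterType M γ c = F.iterType N δ d) ∧
      (∀ δ < β, ∀ d, b <+: d → ∃ γ < α, ∃ c, a <+: c ∧ F.iterType N δ d = F.iterType M γ c) := by
  rw [F.iterType_of_ne_zero M hα, F.iterType_of_ne_zero N hβ, HSet.setOf_eq_iff,
    Set.Subset.antisymm_iff, Set.range_subset_iff, Set.range_subset_iff]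
  simp only [Subtype.forall, Prod.forall, Set.mem_range, Subtype.exists, Prod.exists, and_imp,
    exists_prop, and_assoc, exists_and_left, eq_comm]
  grind

/-- The set `tp^α(a)` does not record the levels of its elements, but they can be recovered: by
induction, an element of level `γ` on one side can only equal one of level `γ` on the other. -/
theorem level_eq_of_iterType_eq {M N : CountableMod L} {α β : Ordinal.{0}} {a b : List ℕ}
    (h : F.iterType M α a = F.iterType N β b) : α = β := by
  induction α using WellFoundedLT.induction generalizing β M N a b with
  | _ α ih =>
    by_cases hα : α = 0
    · subst hα
      by_contra hβ
      rw [F.iterType_zero, F.iterType_of_ne_zero N (Ne.symm hβ)] at h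
      exact HSet.base_ne_setOf h
    by_cases hβ : β = 0
    · subst hβ
      rw [F.iterType_zero, F.iterType_of_ne_zero M hα] at h
      exact absurd h.symm HSet.base_ne_setOf
    obtain ⟨h₁, h₂⟩ := (iterType_eq_iff hα hβ).1 h
    refine le_antisymm (le_of_forall_lt fun γ hγ => ?_) (le_of_forall_lt fun δ hδ => ?_)
    · obtain ⟨δ, hδ, d, -, e⟩ := h₁ γ hγ a List.prefix_rfl
      exact ih γ hγ e ▸ hδ
    · obtain ⟨γ, hγ, c, -, e⟩ := h₂ δ hδ b List.prefix_rfl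
      exact ih γ hγ e.symm ▸ hγ

theorem iterType_eq_iff_same_level {M N : CountableMod L} {α : Ordinal.{0}} (hα : α ≠ 0)
    {a b : List ℕ} : F.iterType M α a = F.iterType N α b ↔
      (∀ γ < α, ∀ c, a <+: c → ∃ d, b <+: d ∧ F.iterType M γ c = F.iterType N γ d) ∧
      (∀ γ < α, ∀ d, b <+: d → ∃ c, a <+: c ∧ F.iterType M γ c = F.iterType N γ d) := by
  rw [iterType_eq_iff hα hα]
  constructor
  · rintro ⟨h₁, h₂⟩
    refine ⟨fun γ hγ c hc => ?_, fun γ hγ d hd => ?_⟩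
    · obtain ⟨δ, -, d, hd, e⟩ := h₁ γ hγ c hc
      exact ⟨d, hd, by rw [e, level_eq_of_iterType_eq e]⟩
    · obtain ⟨δ, -, c, hc, e⟩ := h₂ γ hγ d hd
      exact ⟨c, hc, by rw [e, level_eq_of_iterType_eq e]⟩
  · rintro ⟨h₁, h₂⟩
    exact ⟨fun γ hγ c hc => ⟨γ, hγ, h₁ γ hγ c hc⟩,
      fun γ hγ d hd => ⟨γ, hγ, (h₂ γ hγ d hd).imp fun c hc => ⟨hc.1, hc.2.symm⟩⟩⟩

/-- The `F`-type of `a` is matched by that of an extension `d` of `b`, and vice versa. As types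
carry their arity, `a` and `b` have equal length, so `d = b`. -/
theorem typeOf_eq_of_iterType_eq {M N : CountableMod L} {α : Ordinal.{0}} {a b : List ℕ}
    (h : F.iterType M α a = F.iterType N α b) : F.typeOf M a = F.typeOf N b := by
  by_cases hα : α = 0
  · subst hα
    rwa [F.iterType_zero, F.iterType_zero, HSet.base_inj] at h
  obtain ⟨h₁, h₂⟩ := (iterType_eq_iff_same_level hα).1 h
  obtain ⟨d, hd, e⟩ := h₁ 0 (pos_iff_ne_zero.2 hα) a List.prefix_rfl
  obtain ⟨c, hc, e'⟩ := h₂ 0 (pos_iff_ne_zero.2 hα) b List.prefix_rfl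
  rw [F.iterType_zero, F.iterType_zero, HSet.base_inj] at e e'
  have l₁ := length_eq_of_typeOf_eq e
  have l₂ := length_eq_of_typeOf_eq e'
  have := hd.length_le
  have := hc.length_le
  rw [e, hd.eq_of_length (by omega)]

variable (F)

theorem iterType_map {M N : CountableMod L} (e : @FirstOrder.Language.Equiv L ℕ ℕ M N)
    (α : Ordinal.{0}) (a : List ℕ) :
    F.iterType N α (a.map (isoPerm e)) = F.iterType M α a := by
  induction α using WellFoundedLT.induction generalizing a with
  | _ α ih =>
    by_cases hα : α = 0
    · subst hα
      rw [F.iterType_zero, F.iterType_zero, F.typeOf_map]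
    refine (iterType_eq_iff_same_level hα).2 ⟨fun γ hγ c hc => ?_, fun γ hγ d hd => ?_⟩
    · refine ⟨c.map (isoPerm e).symm, ?_, ?_⟩
      · simpa using hc.map (isoPerm e).symm
      · rw [← ih γ hγ]; simp
    · exact ⟨d.map (isoPerm e), hd.map _, ih γ hγ d⟩

theorem typeOf_smul (g : Equiv.Perm ℕ) (M : CountableMod L) (a : List ℕ) :
    F.typeOf (g • M) (a.map g) = F.typeOf M a :=
  F.typeOf_map (CountableMod.smulEquiv g M) a

theorem iterType_smul (g : Equiv.Perm ℕ) (M : CountableMod L) (α : Ordinal.{0}) (a : List ℕ) :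
    F.iterType (g • M) α (a.map g) = F.iterType M α a :=
  F.iterType_map (CountableMod.smulEquiv g M) α a

end LFragment

end Types

/-! ### Unfolding the game one turn at a time -/

section Game

variable {G : Type v} {X : Type w} [Group G] [MulAction G X]

/-- A move of Odd that follows the rules when the previous data are given by `o` and the current
point is `q`. -/
def OddMove.IsLegal [TopologicalSpace X] (𝒱 : Set (Set G)) (o : OddMove G X) (q : X)
    (m : OddMove G X) : Prop :=
  ((m.V = o.V ∧ m.ord = o.ord) ∨ (m.V ∈ 𝒱 ∧ m.ord < o.ord)) ∧ IsOpen m.U ∧ q ∈ m.U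

/-- After one turn the rest of the play is a play of the same kind of game, with the two points
exchanged. -/
theorem gamePoint_succ (x y : X) (g : ℕ → G) (t : ℕ) :
    gamePoint x y g (t + 1) = gamePoint (g 0 • y) x (fun i => g (i + 1)) t := by
  induction t using Nat.twoStepInduction with
  | zero => rfl
  | one => rfl
  | more t ih _ =>
    exact congrArg (g (t + 1) • ·) ih

/-- The strategy `s` after the first move `m` of Odd. -/
def strategyAfter (s : List (OddMove G X) → G) (m : OddMove G X) (l : List (OddMove G X)) : G :=
  s (m :: l)

theorem strategyMoves_succ (s : List (OddMove G X) → G) (o : ℕ → OddMove G X) (t : ℕ) :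
    strategyMoves s o (t + 1) = strategyMoves (strategyAfter s (o 1)) (fun i => o (i + 1)) t := by
  simp only [strategyMoves, strategyAfter]
  rw [List.ofFn_succ]
  rfl

theorem strategyMoves_zero (s : List (OddMove G X) → G) (o : ℕ → OddMove G X) :
    strategyMoves s o 0 = s [o 1] := rfl

/-- The strategy given by the replies `f p q o m` to the moves `m`, where `p` is the point to be
moved, `q` is the other point, and `o` is the previous move of Odd. -/
def strategyOfReply (f : X → X → OddMove G X → OddMove G X → G) :
    X → X → OddMove G X → List (OddMove G X) → G
  | _, _, _, [] => 1
  | p, q, o, [m] => f p q o m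
  | p, q, o, m :: m' :: l => strategyOfReply f q (f p q o m • p) m (m' :: l)

theorem strategyMoves_strategyOfReply_succ (f : X → X → OddMove G X → OddMove G X → G) (p q : X)
    (m : OddMove G X) (o : ℕ → OddMove G X) (t : ℕ) :
    strategyMoves (strategyOfReply f p q m) o (t + 1) =
      strategyMoves (strategyOfReply f q (f p q m (o 1) • p) (o 1)) (fun i => o (i + 1)) t := by
  rw [strategyMoves_succ]
  simp only [strategyMoves, strategyAfter, List.ofFn_succ]
  rfl

variable [TopologicalSpace X] {𝒱 : Set (Set G)}

theorem oddLegal_iff {x y : X} {o : ℕ → OddMove G X} {g : ℕ → G} :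
    OddLegal x y 𝒱 o g ↔ (o 0).IsLegal 𝒱 x (o 1) ∧
      OddLegal (g 0 • y) x 𝒱 (fun i => o (i + 1)) (fun i => g (i + 1)) := by
  constructor
  · intro h
    refine ⟨h 0, fun t => ?_⟩
    have := h (t + 1)
    rwa [gamePoint_succ] at this
  · rintro ⟨h₀, h⟩ (_ | t)
    · exact h₀
    · rw [gamePoint_succ]
      exact h t

theorem eveWins_iff {x y : X} {o : ℕ → OddMove G X} {g : ℕ → G} :
    EveWins x y o g ↔ x ∈ closure (o 0).U ∧ IsLocalMove (o 0).V (o 0).U y (g 0) ∧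
      EveWins (g 0 • y) x (fun i => o (i + 1)) (fun i => g (i + 1)) := by
  constructor
  · intro h
    refine ⟨(h 0).1, (h 0).2, fun t => ?_⟩
    have := h (t + 1)
    rwa [gamePoint_succ x y g (t + 1), gamePoint_succ x y g t] at this
  · rintro ⟨h₀, h₁, h⟩ (_ | t)
    · exact ⟨h₀, h₁⟩
    · rw [gamePoint_succ x y g (t + 1), gamePoint_succ x y g t]
      exact h t

/-- The play in which Odd starts with `m` and afterwards passes. -/
def OddMove.thenPass (m : OddMove G X) : ℕ → OddMove G X
  | 0 => m
  | _ + 1 => ⟨m.V, m.ord, Set.univ⟩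

/-- A winning strategy constrains only legal plays, so reading off its first reply requires some
legal continuation; this one is legal whatever Eve does. -/
theorem OddMove.thenPass_legal (x y : X) (m : OddMove G X) (g : ℕ → G) :
    OddLegal x y 𝒱 m.thenPass g := by
  rintro (_ | t) <;> exact ⟨Or.inl ⟨rfl, rfl⟩, isOpen_univ, Set.mem_univ _⟩

theorem EveHasWinningStrategy.mem_closure {α : Ordinal.{0}} {x y : X} {V : Set G} {U : Set X}
    (h : EveHasWinningStrategy α x y 𝒱 V U) : x ∈ closure U := by
  obtain ⟨s, hs⟩ := h
  exact (hs (OddMove.thenPass ⟨V, α, U⟩) rfl (OddMove.thenPass_legal _ _ _ _) 0).1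

theorem EveHasWinningStrategy.exists_reply {α : Ordinal.{0}} {x y : X} {V : Set G} {U : Set X}
    (h : EveHasWinningStrategy α x y 𝒱 V U) {m : OddMove G X}
    (hm : OddMove.IsLegal 𝒱 ⟨V, α, U⟩ x m) :
    ∃ g : G, IsLocalMove V U y g ∧ EveHasWinningStrategy m.ord (g • y) x 𝒱 m.V m.U := by
  obtain ⟨s, hs⟩ := h
  have key : ∀ o : ℕ → OddMove G X, o 0 = m →
      OddLegal (s [m] • y) x 𝒱 o (strategyMoves (strategyAfter s m) o) →
      IsLocalMove V U y (s [m]) ∧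
        EveWins (s [m] • y) x o (strategyMoves (strategyAfter s m) o) := by
    rintro o rfl ho
    -- The initial data are put in front of the play `o` that begins with `m`.
    have := hs (fun t => Nat.casesOn t ⟨V, α, U⟩ o) rfl (oddLegal_iff.2 ⟨hm, by
      simp only [strategyMoves_succ, strategyMoves_zero]
      exact ho⟩)
    rw [eveWins_iff] at this
    simp only [strategyMoves_succ, strategyMoves_zero] at this
    exact this.2
  exact ⟨s [m], (key m.thenPass rfl (OddMove.thenPass_legal _ _ _ _)).1, strategyAfter s m,
    fun o ho hl => (key o ho hl).2⟩

/-- `I p q o` concerns the point `p` to be moved, the other point `q`, and Odd's previous move. The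
two points change roles after each reply, so one invariant serves both. -/
theorem eveHasWinningStrategy_of_invariant (I : X → X → OddMove G X → Prop)
    (hI : ∀ p q o, I p q o → q ∈ closure o.U)
    (hstep : ∀ p q o m, I p q o → OddMove.IsLegal 𝒱 o q m →
      ∃ g : G, IsLocalMove o.V o.U p g ∧ I q (g • p) m)
    {α : Ordinal.{0}} {x y : X} {V : Set G} {U : Set X} (h : I y x ⟨V, α, U⟩) :
    EveHasWinningStrategy α x y 𝒱 V U := by
  classical
  have : ∀ p q o m, ∃ g : G, I p q o → OddMove.IsLegal 𝒱 o q m →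
      IsLocalMove o.V o.U p g ∧ I q (g • p) m := by
    intro p q o m
    by_cases h : I p q o ∧ OddMove.IsLegal 𝒱 o q m
    · obtain ⟨g, hg⟩ := hstep p q o m h.1 h.2
      exact ⟨g, fun _ _ => hg⟩
    · exact ⟨1, fun h₁ h₂ => (h ⟨h₁, h₂⟩).elim⟩
  choose f hf using this
  refine ⟨strategyOfReply f y x ⟨V, α, U⟩, fun o ho hl t => ?_⟩
  -- The initial data become `o 0`, so that the induction can pass to the shifted play.
  rw [← ho] at h hl ⊢
  clear ho
  induction t generalizing x y o with
  | zero => exact ⟨hI _ _ _ h, (hf y x (o 0) (o 1) h (hl 0)).1⟩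
  | succ t ih =>
    rw [oddLegal_iff] at hl
    simp only [strategyMoves_strategyOfReply_succ] at hl
    have := ih (fun i => o (i + 1)) (hf y x (o 0) (o 1) h hl.1).2 hl.2
    rw [gamePoint_succ x y _ (t + 1), gamePoint_succ x y _ t]
    simp only [strategyMoves_strategyOfReply_succ]
    exact this

end Game

/-! ### Stabilizers of finite tuples in `Sym(ℕ)` -/

section Stabilizers

open scoped Topology

/-- The permutations that fix all members of the list `a`. -/
def stab (a : List ℕ) : Set (Equiv.Perm ℕ) := {g | ∀ i ∈ a, g i = i}

theorem map_eq_self_of_mem_stab {a : List ℕ} {g : Equiv.Perm ℕ} (h : g ∈ stab a) :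
    a.map g = a :=
  (List.map_congr_left h).trans (List.map_id a)

theorem continuous_apply_perm (n : ℕ) :
    @Continuous _ _ symTopology _ (fun g : Equiv.Perm ℕ => g n) := by
  letI := symTopology
  exact (continuous_apply n).comp continuous_induced_dom

theorem isOpen_stab (a : List ℕ) : IsOpen[symTopology] (stab a) := by
  letI := symTopology
  have : stab a = ⋂ i ∈ a.toFinset, (fun g : Equiv.Perm ℕ => g i) ⁻¹' {i} := by
    ext g
    simp [stab]
  rw [this]
  exact isOpen_biInter_finset fun i _ => (isOpen_discrete _).preimage (continuous_apply_perm i)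

/-- Basic neighborhoods of a permutation in the topology of pointwise convergence. -/
theorem exists_agree_subset {U : Set (Equiv.Perm ℕ)} (hU : IsOpen[symTopology] U)
    {g : Equiv.Perm ℕ} (hg : g ∈ U) : ∃ n, ∀ h : Equiv.Perm ℕ, (∀ i < n, h i = g i) → h ∈ U := by
  obtain ⟨W, hW, rfl⟩ := isOpen_induced_iff.1 hU
  obtain ⟨I, u, hu, hI⟩ := isOpen_pi_iff.1 hW _ hg
  refine ⟨I.sup id + 1, fun h hh => hI fun i hi => ?_⟩
  have : i ≤ I.sup id := Finset.le_sup (f := id) hi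
  show h i ∈ u i
  rw [hh i (by omega)]
  exact (hu i hi).2

theorem exists_perm_map_eq {a b : List ℕ} (ha : a.Nodup) (hb : b.Nodup)
    (h : a.length = b.length) : ∃ g : Equiv.Perm ℕ, a.map g = b := by
  have := (Equiv.Perm.isMultiplyPretransitive ℕ a.length).exists_smul_eq
    ⟨a.get, List.nodup_iff_injective_get.1 ha⟩
    ⟨b.get ∘ Fin.cast h, (List.nodup_iff_injective_get.1 hb).comp (Fin.cast_injective h)⟩
  obtain ⟨g, hg⟩ := this
  refine ⟨g, List.ext_get (by simpa using h) fun n h₁ h₂ => ?_⟩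
  have := DFunLike.congr_fun hg ⟨n, by simpa using h₁⟩
  simpa using this

theorem mem_stab_of_map_eq {a b c : List ℕ} {g : Equiv.Perm ℕ} (hb : a <+: b) (hc : a <+: c)
    (h : b.map g = c) : g ∈ stab a := by
  have h₁ : a.map g <+: c := h ▸ hb.map g
  have h₂ : a.map g = a := (List.prefix_of_prefix_length_le h₁ hc (by simp)).eq_of_length (by simp)
  intro i hi
  obtain ⟨k, hk, rfl⟩ := List.getElem_of_mem hi
  have := List.getElem_map g (l := a) (i := k) (h := by simpa using hk)
  simpa [h₂] using this.symm

theorem exists_nodup_prefix {a : List ℕ} (ha : a.Nodup) (n : ℕ) :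
    ∃ b : List ℕ, a <+: b ∧ b.Nodup ∧ ∀ i < n, i ∈ b := by
  refine ⟨a ++ (List.range n).filter (· ∉ a), List.prefix_append _ _, ?_, fun i hi => ?_⟩
  · refine List.nodup_append'.2 ⟨ha, List.nodup_range.filter _, fun i hi hi' => ?_⟩
    simp only [List.mem_filter, decide_eq_true_eq] at hi'
    exact hi'.2 hi
  · by_cases h : i ∈ a <;> simp [h, hi]

end Stabilizers

theorem IsLocalMove.of_mem {G : Type v} {X : Type w} [Group G] [MulAction G X] {V : Set G}
    {U : Set X} {z : X} {g : G} (hV : g ∈ V) (hU : g • z ∈ U) : IsLocalMove V U z g :=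
  ⟨0, fun _ => g, rfl, fun i hi => by obtain rfl := Nat.le_zero.1 hi; exact ⟨hV, hU⟩⟩

/-- Stabilizers are closed under products, so splitting a move into small steps gains Eve nothing
here. -/
theorem IsLocalMove.mem_stab {X : Type w} [MulAction (Equiv.Perm ℕ) X] {a : List ℕ}
    {U : Set X} {z : X} {g : Equiv.Perm ℕ} (h : IsLocalMove (stab a) U z g) : g ∈ stab a := by
  obtain ⟨k, f, rfl, hf⟩ := h
  induction k with
  | zero => exact (hf 0 le_rfl).1
  | succ k ih =>
    intro i hi
    show f (k + 1) (descProd f k i) = i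
    rw [ih (fun j hj => hf j (by omega)) i hi, (hf (k + 1) le_rfl).1 i hi]

/-! ### The topology `t_F` and the game for the logic action -/

section Topology

open scoped Topology

variable {L : FirstOrder.Language.{u, v}} {F : LFragment L}

namespace LFragment

theorem isOpen_realize {n : ℕ} {φ : InfFormula L n} (hφ : φ ∈ F.formulas n) (a : Fin n → ℕ) :
    IsOpen[F.topology] {M : CountableMod L | φ.Realize M a} :=
  TopologicalSpace.isOpen_generateFrom_of_mem ⟨n, φ, a, hφ, rfl⟩

/-- Because `F` is closed under negation, the closures in Eve's winning condition do not weaken it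
for these sets. -/
theorem isClosed_realize {n : ℕ} {φ : InfFormula L n} (hφ : φ ∈ F.formulas n) (a : Fin n → ℕ) :
    IsClosed[F.topology] {M : CountableMod L | φ.Realize M a} := by
  letI := F.topology
  exact ⟨isOpen_realize (F.neg_mem_iff.2 hφ) a⟩

/-- The generating sets already form a base: two of them intersect in the set of a conjunction with
variables renamed apart. -/
theorem exists_realize_subset {U : Set (CountableMod L)} (hU : IsOpen[F.topology] U)
    {M : CountableMod L} (hM : M ∈ U) :
    ∃ (n : ℕ) (φ : InfFormula L n) (a : Fin n → ℕ), φ ∈ F.formulas n ∧ φ.Realize M a ∧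
      {N : CountableMod L | φ.Realize N a} ⊆ U := by
  induction hU with
  | basic S hS =>
    obtain ⟨n, φ, a, hφ, rfl⟩ := hS
    exact ⟨n, φ, a, hφ, hM, subset_rfl⟩
  | univ =>
    exact ⟨0, InfFormula.falsum.neg, Fin.elim0, F.neg_mem_iff.2 F.falsum_mem, not_false,
      Set.subset_univ _⟩
  | inter S T _ _ ihS ihT =>
    obtain ⟨n, φ, a, hφ, hMφ, hS⟩ := ihS hM.1
    obtain ⟨m, ψ, b, hψ, hMψ, hT⟩ := ihT hM.2
    have key : ∀ N : CountableMod L,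
        ((φ.subst fun i => FirstOrder.Language.Term.var (Fin.castAdd m i)).and
          (ψ.subst fun i => FirstOrder.Language.Term.var (Fin.natAdd n i))).Realize N
            (Fin.append a b) ↔ φ.Realize N a ∧ ψ.Realize N b := by
      intro N
      simp only [InfFormula.Realize, InfFormula.realize_subst_var]
      have h₁ : Fin.append a b ∘ Fin.castAdd m = a := by ext i; simp
      have h₂ : Fin.append a b ∘ Fin.natAdd n = b := by ext i; simp
      rw [h₁, h₂]
    exact ⟨n + m, _, Fin.append a b, F.and_mem_iff.2 ⟨F.subst_mem _ hφ, F.subst_mem _ hψ⟩,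
      (key M).2 ⟨hMφ, hMψ⟩, fun N hN => ⟨hS ((key N).1 hN).1, hT ((key N).1 hN).2⟩⟩
  | sUnion 𝒮 _ ih =>
    obtain ⟨S, hS, hMS⟩ := hM
    obtain ⟨n, φ, a, hφ, hMφ, h⟩ := ih S hS hMS
    exact ⟨n, φ, a, hφ, hMφ, h.trans (Set.subset_sUnion_of_mem hS)⟩

/-- Open sets contain neighborhoods given by formulas about the tuple listed by `b`, for every list
`b` that contains sufficiently many natural numbers. -/
theorem exists_realize_tuple_subset {U : Set (CountableMod L)} (hU : IsOpen[F.topology] U)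
    {M : CountableMod L} (hM : M ∈ U) :
    ∃ k, ∀ (b : List ℕ) (n : ℕ), b.length = n → (∀ i < k, i ∈ b) → ∃ φ ∈ F.formulas n,
      φ.Realize M (b.tuple n) ∧ ∀ N : CountableMod L, φ.Realize N (b.tuple n) → N ∈ U := by
  obtain ⟨n, φ, a, hφ, hMφ, hsub⟩ := exists_realize_subset hU hM
  -- One more than the largest parameter, so that `b` lists every parameter of `φ`.
  refine ⟨Finset.univ.sup a + 1, ?_⟩
  rintro b _ rfl hb
  obtain ⟨f, hf⟩ := List.exists_tuple_comp (d := a) (b := b)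
    fun i => hb _ (Nat.lt_succ_of_le (Finset.le_sup (Finset.mem_univ i)))
  refine ⟨_, F.subst_mem (fun i => FirstOrder.Language.Term.var (f i)) hφ, ?_, fun N hN => hsub ?_⟩
  · rwa [InfFormula.realize_subst_var, ← hf]
  · rwa [InfFormula.realize_subst_var, ← hf] at hN

theorem iterType_eq_of_eveHasWinningStrategy {α : Ordinal.{0}} {M N : CountableMod L} {a : List ℕ}
    {U : Set (CountableMod L)}
    (h : @EveHasWinningStrategy (Equiv.Perm ℕ) _ _ _ F.topology α M N
      {V | IsOpen[symTopology] V ∧ 1 ∈ V} (stab a) U) :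
    F.iterType M α a = F.iterType N α a := by
  letI := F.topology
  induction α using WellFoundedLT.induction generalizing M N a U with
  | _ α ih =>
    have pass : ∀ W : Set (CountableMod L), IsOpen W → M ∈ W → ∃ g ∈ stab a,
        EveHasWinningStrategy α (g • N) M {V | IsOpen[symTopology] V ∧ 1 ∈ V} (stab a) W := by
      intro W hW hM
      obtain ⟨g, hg, h'⟩ := h.exists_reply (m := ⟨stab a, α, W⟩) ⟨Or.inl ⟨rfl, rfl⟩, hW, hM⟩
      exact ⟨g, hg.mem_stab, h'⟩
    have smul : ∀ g ∈ stab a, ∀ β, F.iterType (g • N) β a = F.iterType N β a := by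
      intro g hg β
      conv_lhs => rw [← map_eq_self_of_mem_stab hg]
      exact F.iterType_smul g N β a
    by_cases hα : α = 0
    · subst hα
      rw [F.iterType_zero, F.iterType_zero]
      refine congrArg _ (typeOf_eq_of_forall rfl rfl fun φ hφ hM => ?_)
      obtain ⟨g, hg, h'⟩ := pass _ (isOpen_realize hφ _) hM
      have hgN := (isClosed_realize hφ _).closure_subset h'.mem_closure
      have := smul g hg 0
      rw [F.iterType_zero, F.iterType_zero, HSet.base_inj] at this
      exact (realize_iff_of_typeOf_eq this rfl hφ).1 hgN
    have half : ∀ {P Q : CountableMod L} {W : Set (CountableMod L)},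
        EveHasWinningStrategy α P Q {V | IsOpen[symTopology] V ∧ 1 ∈ V} (stab a) W →
        ∀ γ < α, ∀ c, a <+: c → ∃ d, a <+: d ∧ F.iterType P γ c = F.iterType Q γ d := by
      intro P Q W hPQ γ hγ c hc
      obtain ⟨g, hg, h'⟩ := hPQ.exists_reply (m := ⟨stab c, γ, Set.univ⟩)
        ⟨Or.inr ⟨⟨isOpen_stab c, fun i _ => rfl⟩, hγ⟩, isOpen_univ, Set.mem_univ _⟩
      -- The tuple `c` in `g • Q` looks like `g⁻¹c` in `Q`, and `g⁻¹c` still extends `a` because `g`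
      -- fixes `a`.
      refine ⟨c.map g.symm, ?_, ?_⟩
      · have hg' : g.symm ∈ stab a := fun i hi => by
          rw [Equiv.symm_apply_eq, hg.mem_stab i hi]
        conv_lhs => rw [← map_eq_self_of_mem_stab hg']
        exact hc.map _
      · rw [← ih γ hγ h', ← F.iterType_smul g Q γ (c.map g.symm)]
        simp
    refine (iterType_eq_iff_same_level hα).2 ⟨half h, fun γ hγ d hd => ?_⟩
    -- The converse inclusion is `half` with the structures exchanged, which Odd achieves by passing
    -- once.
    obtain ⟨g, hg, h'⟩ := pass Set.univ isOpen_univ (Set.mem_univ _)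
    have hd' : a <+: d.map g := by
      conv_lhs => rw [← map_eq_self_of_mem_stab hg]
      exact hd.map _
    obtain ⟨c, hc, e⟩ := half h' γ hγ _ hd'
    exact ⟨c, hc, by rw [← e, F.iterType_smul]⟩

/-- The positions from which Eve wins: the point `N` is to be moved by elements of `o.V`, and the
other point is `M`. -/
def GameInvariant (F : LFragment L) (N M : CountableMod L)
    (o : OddMove (Equiv.Perm ℕ) (CountableMod L)) : Prop :=
  IsOpen[F.topology] o.U ∧ M ∈ o.U ∧
    ∃ a : List ℕ, a.Nodup ∧ stab a ⊆ o.V ∧ F.iterType N o.ord a = F.iterType M o.ord a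

theorem GameInvariant.exists_reply {N M : CountableMod L}
    {o m : OddMove (Equiv.Perm ℕ) (CountableMod L)} (h : F.GameInvariant N M o)
    (hm : @OddMove.IsLegal _ _ F.topology {V | IsOpen[symTopology] V ∧ 1 ∈ V} o M m) :
    ∃ g : Equiv.Perm ℕ, IsLocalMove o.V o.U N g ∧ F.GameInvariant M (g • N) m := by
  letI := F.topology
  obtain ⟨hU, hMU, a, ha, haV, hty⟩ := h
  obtain ⟨hV, hmU, hMmU⟩ := hm
  -- The moved point must lie in `o.U` for the move to be local and in `m.U` for the invariant to
  -- persist.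
  obtain ⟨k, hk⟩ := exists_realize_tuple_subset (hU.inter hmU) ⟨hMU, hMmU⟩
  rcases hV with ⟨hV, hord⟩ | ⟨⟨hV, hone⟩, hord⟩
  -- Odd keeps `V` and the ordinal: one formula about `b` suffices, and `a` remains the witness.
  · obtain ⟨b, hab, hb, hkb⟩ := exists_nodup_prefix ha k
    obtain ⟨φ, hφ, hMφ, hφU⟩ := hk b _ rfl hkb
    obtain ⟨c, hac, hc, hlen, hNφ⟩ :=
      exists_nodup_extension (typeOf_eq_of_iterType_eq hty).symm hab hb hφ hMφ
    obtain ⟨g, rfl⟩ := exists_perm_map_eq hc hb hlen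
    have hg : g ∈ stab a := mem_stab_of_map_eq hac hab rfl
    have hgN : g • N ∈ o.U ∩ m.U := by
      apply hφU
      rw [List.tuple_map (by simp)]
      exact (InfFormula.realize_smul g N _ _).2 hNφ
    refine ⟨g, IsLocalMove.of_mem (haV hg) hgN.1, hmU, hgN.2, a, ha, hV ▸ haV, ?_⟩
    rw [hord, ← hty, ← F.iterType_smul g, map_eq_self_of_mem_stab hg]
  -- Odd lowers the ordinal: `b` is chosen so long that also `stab b ⊆ m.V`, its whole type of the
  -- new level is matched, and `b` is the next witness.
  · obtain ⟨k', hk'⟩ := exists_agree_subset hV hone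
    obtain ⟨b, hab, hb, hkb⟩ := exists_nodup_prefix ha (max k k')
    obtain ⟨φ, hφ, hMφ, hφU⟩ := hk b _ rfl fun i hi => hkb i (by omega)
    have hne : o.ord ≠ 0 := (bot_le.trans_lt hord).ne'
    obtain ⟨c, hac, e⟩ := ((iterType_eq_iff_same_level hne).1 hty).2 _ hord b hab
    have e₀ := typeOf_eq_of_iterType_eq e
    have hc := nodup_of_typeOf_eq e₀.symm hb
    obtain ⟨g, rfl⟩ := exists_perm_map_eq hc hb (length_eq_of_typeOf_eq e₀)
    rw [← F.typeOf_smul g] at e₀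
    rw [← F.iterType_smul g] at e
    have hg : g ∈ stab a := mem_stab_of_map_eq hac hab rfl
    have hgN : g • N ∈ o.U ∩ m.U := hφU _ ((realize_iff_of_typeOf_eq e₀ rfl hφ).2 hMφ)
    exact ⟨g, IsLocalMove.of_mem (haV hg) hgN.1, hmU, hgN.2, _, hb,
      fun h hh => hk' h fun i hi => hh i (hkb i (by omega)), e.symm⟩

theorem apprRel_iff {α : Ordinal.{0}} {M N : CountableMod L} :
    F.ApprRel α M N ↔ F.iterTheory α N = F.iterTheory α M := by
  letI := F.topology
  have huniv : stab [] = Set.univ := by ext; simp [stab]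
  constructor
  · intro h
    refine (iterType_eq_of_eveHasWinningStrategy (U := Set.univ) (a := []) ?_).symm
    rw [huniv]
    exact h
  · intro h
    refine eveHasWinningStrategy_of_invariant F.GameInvariant
      (fun _ _ _ hI => subset_closure hI.2.1) (fun _ _ _ _ => GameInvariant.exists_reply) ?_
    exact ⟨isOpen_univ, Set.mem_univ _, [], List.nodup_nil, Set.subset_univ _, h⟩

end LFragment

end Topology

/-! ### Baire category in `Sym(ℕ)` and Borel isomorphism classes -/

section Generic

open scoped Topology
open Filter

attribute [local instance] symTopology

theorem continuous_inv_apply_perm (n : ℕ) : Continuous fun g : Equiv.Perm ℕ => g⁻¹ n := by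
  refine continuous_discrete_rng.2 fun m => ?_
  have : (fun g : Equiv.Perm ℕ => g⁻¹ n) ⁻¹' {m} = (fun g : Equiv.Perm ℕ => g m) ⁻¹' {n} := by
    ext g
    simp only [Set.mem_preimage, Set.mem_singleton_iff, Equiv.Perm.inv_eq_iff_eq]
    exact eq_comm
  rw [this]
  exact (isOpen_discrete _).preimage (continuous_apply_perm m)

/-- The map `g ↦ (g, g⁻¹)` embeds `Sym(ℕ)` as a closed subset of a Polish space. -/
theorem baireSpace_perm : BaireSpace (Equiv.Perm ℕ) := by
  let f : Equiv.Perm ℕ → (ℕ → ℕ) × (ℕ → ℕ) := fun g => (g, ⇑g⁻¹)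
  have hf : Continuous f :=
    continuous_induced_dom.prodMk (continuous_pi continuous_inv_apply_perm)
  have hrange : Set.range f = {p | ∀ n, p.1 (p.2 n) = n ∧ p.2 (p.1 n) = n} := by
    ext p
    constructor
    · rintro ⟨g, rfl⟩ n
      simp [f]
    · intro h
      exact ⟨⟨p.1, p.2, fun n => (h n).2, fun n => (h n).1⟩, rfl⟩
  have hclosed : IsClosed (Set.range f) := by
    have happ : Continuous fun p : (ℕ → ℕ) × ℕ => p.1 p.2 :=
      continuous_prod_of_discrete_right.2 fun m => continuous_apply m
    rw [hrange]
    simp only [Set.ofPred_forall]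
    refine isClosed_iInter fun n => IsClosed.and ?_ ?_
    · exact isClosed_eq (happ.comp
        (continuous_fst.prodMk ((continuous_apply n).comp continuous_snd))) continuous_const
    · exact isClosed_eq (happ.comp
        (continuous_snd.prodMk ((continuous_apply n).comp continuous_fst))) continuous_const
  have hind : Topology.IsInducing f :=
    Topology.IsInducing.of_comp hf continuous_fst ⟨rfl⟩
  have hinj : Function.Injective f := fun g h e =>
    DFunLike.coe_injective (congrArg Prod.fst e)
  have := (Topology.IsClosedEmbedding.mk ⟨hind, hinj⟩ hclosed).polishSpace
  letI := TopologicalSpace.upgradeIsCompletelyMetrizable (Equiv.Perm ℕ)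
  infer_instance

/-- The permutations that extend the finite map listed by `b`. -/
def cylinder (b : List ℕ) : Set (Equiv.Perm ℕ) := {h | (List.range b.length).map h = b}

theorem isOpen_cylinder (b : List ℕ) : IsOpen (cylinder b) := by
  have : cylinder b = ⋂ i : Fin b.length, (fun g : Equiv.Perm ℕ => g i) ⁻¹' {b[i]} := by
    ext g
    simp only [cylinder, Set.mem_ofPred_eq, Set.mem_iInter, Set.mem_preimage,
      Set.mem_singleton_iff]
    constructor
    · intro h i
      have : ((List.range b.length).map g)[(i : ℕ)]'(by simp) = b[(i : ℕ)] := by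
        simp only [h]
      simpa using this
    · intro h
      refine List.ext_getElem (by simp) fun n h₁ h₂ => ?_
      simpa using h ⟨n, h₂⟩
  rw [this]
  exact isOpen_iInter_of_finite fun i =>
    (isOpen_discrete _).preimage (continuous_apply_perm _)

theorem cylinder_nonempty {b : List ℕ} (hb : b.Nodup) : (cylinder b).Nonempty :=
  exists_perm_map_eq List.nodup_range hb (by simp)

theorem cylinder_subset {b c : List ℕ} (h : b <+: c) : cylinder c ⊆ cylinder b := by
  intro g hg
  have hr : List.range b.length <+: List.range c.length := by
    obtain ⟨k, hk⟩ := Nat.exists_eq_add_of_le h.length_le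
    rw [hk, List.range_add]
    exact List.prefix_append _ _
  have : (List.range b.length).map g <+: c := by
    conv_rhs => rw [← show (List.range c.length).map g = c from hg]
    exact hr.map _
  exact (List.prefix_of_prefix_length_le this h (by simp)).eq_of_length (by simp)

theorem exists_cylinder {b : List ℕ} {g : Equiv.Perm ℕ} (hg : g ∈ cylinder b) (n : ℕ) :
    ∃ k, n ≤ k ∧ b <+: (List.range k).map g ∧ ((List.range k).map g).Nodup ∧
      g ∈ cylinder ((List.range k).map g) := by
  refine ⟨b.length + n, by omega, ?_, List.nodup_range.map g.injective, by simp [cylinder]⟩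
  conv_lhs => rw [← show (List.range b.length).map g = b from hg]
  rw [List.range_add]
  exact (List.prefix_append _ _).map _

theorem exists_cylinder_subset {U : Set (Equiv.Perm ℕ)} (hU : IsOpen U) {b : List ℕ}
    {g : Equiv.Perm ℕ} (hgU : g ∈ U) (hg : g ∈ cylinder b) :
    ∃ c : List ℕ, b <+: c ∧ c.Nodup ∧ cylinder c ⊆ U := by
  obtain ⟨n, hn⟩ := exists_agree_subset hU hgU
  obtain ⟨k, hk, hb, hnd, -⟩ := exists_cylinder hg n
  refine ⟨_, hb, hnd, fun h hh => hn h fun i hi => ?_⟩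
  simp only [cylinder, Set.mem_ofPred_eq, List.length_map, List.length_range,
    List.map_inj_left, List.mem_range] at hh
  exact hh i (by omega)

theorem exists_mem_cylinder {P : Equiv.Perm ℕ → Prop} (h : ∀ᶠ g in residual _, P g) {b : List ℕ}
    (hb : b.Nodup) : ∃ g ∈ cylinder b, P g := by
  have := baireSpace_perm
  exact (dense_of_mem_residual h).inter_open_nonempty _ (isOpen_cylinder b) (cylinder_nonempty hb)

variable {L : FirstOrder.Language.{u, v}} {F : LFragment L}

namespace LFragment

theorem realize_inv_smul_iff {M : CountableMod L} {b : List ℕ} {n : ℕ} (hb : b.length = n)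
    {g : Equiv.Perm ℕ} (hg : g ∈ cylinder b) (φ : InfFormula L n) :
    φ.Realize (g⁻¹ • M) ((List.range n).tuple n) ↔ φ.Realize M (b.tuple n) := by
  subst hb
  rw [← InfFormula.realize_smul g (g⁻¹ • M), smul_inv_smul, ← List.tuple_map (by simp),
    show (List.range b.length).map g = b from hg]

/-- The truth of `φ(a)` in `g⁻¹ • M` is that of `φ(g a)` in `M`, which depends on finitely many
values of `g`. -/
theorem isOpen_setOf_inv_smul_mem {U : Set (CountableMod L)} (hU : IsOpen[F.topology] U)
    (M : CountableMod L) : IsOpen {g : Equiv.Perm ℕ | g⁻¹ • M ∈ U} := by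
  letI := F.topology
  suffices h : Continuous fun g : Equiv.Perm ℕ => g⁻¹ • M from hU.preimage h
  refine continuous_generateFrom_iff.2 ?_
  rintro _ ⟨n, φ, a, -, rfl⟩
  have : (fun g : Equiv.Perm ℕ => g⁻¹ • M) ⁻¹' {N : CountableMod L | φ.Realize N a} =
      (fun g : Equiv.Perm ℕ => (fun i => g (a i) : Fin n → ℕ)) ⁻¹' {c | φ.Realize M c} := by
    ext g
    have := InfFormula.realize_smul g (g⁻¹ • M) φ a
    rw [smul_inv_smul] at this
    exact this.symm
  rw [this]
  exact (isOpen_discrete _).preimage (continuous_pi fun i => continuous_apply_perm (a i))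

theorem baireMeasurableSet_setOf_inv_smul_mem {δ : Ordinal.{0}} {S : Set (CountableMod L)}
    (hS : @IsBorelSigma _ F.topology δ S) (M : CountableMod L) :
    BaireMeasurableSet {g : Equiv.Perm ℕ | g⁻¹ • M ∈ S} := by
  letI := F.topology
  induction hS with
  | of_isOpen S hS => exact (isOpen_setOf_inv_smul_mem hS M).baireMeasurableSet
  | iUnion α β S _ _ ih =>
    have : {g : Equiv.Perm ℕ | g⁻¹ • M ∈ ⋃ n, S n} = ⋃ n, {g : Equiv.Perm ℕ | g⁻¹ • M ∈ S n} := by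
      ext; simp
    rw [this]
    exact BaireMeasurableSet.iUnion fun n => (ih n).of_compl

/-- A failure at `g` is caused by a formula about a finite part of `g` extending `c`. Equality of
`F`-types moves this formula to an extension `d` of `b`, and then no `g'` in the cylinder of `d`
sends `M` into `A`, against genericity. -/
theorem forall_inv_smul_mem_of_isClosed {A : Set (CountableMod L)} (hA : IsClosed[F.topology] A)
    {M N : CountableMod L} {b c : List ℕ} (h : F.typeOf M b = F.typeOf N c)
    (hM : ∀ᶠ g in residual (Equiv.Perm ℕ), g ∈ cylinder b → g⁻¹ • M ∈ A) {g : Equiv.Perm ℕ}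
    (hg : g ∈ cylinder c) : g⁻¹ • N ∈ A := by
  letI := F.topology
  by_contra hgA
  obtain ⟨n, hn⟩ := exists_realize_tuple_subset hA.isOpen_compl hgA
  obtain ⟨k, hk, hc, hnd, hgk⟩ := exists_cylinder hg n
  have hlen' : ((List.range k).map g).length = k := by simp
  generalize (List.range k).map g = c' at *
  obtain ⟨φ, hφ, hgφ, hφA⟩ := hn (List.range c'.length) c'.length (by simp) fun i hi =>
    List.mem_range.2 (by omega)
  obtain ⟨d, hd, hdn, hlen, hMd⟩ := exists_nodup_extension h.symm hc hnd hφ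
    ((realize_inv_smul_iff rfl hgk φ).1 hgφ)
  obtain ⟨g', hg', hg'A⟩ := exists_mem_cylinder hM hdn
  exact hφA _ ((realize_inv_smul_iff hlen hg' φ).2 hMd) (hg'A (cylinder_subset hd hg'))

end LFragment

theorem IsBorelSigma.one_le {X : Type w} [TopologicalSpace X] {δ : Ordinal.{0}} {S : Set X}
    (hS : IsBorelSigma δ S) : 1 ≤ δ := by
  induction hS with
  | of_isOpen => exact le_rfl
  | iUnion α β S h _ ih => exact (ih 0).trans (h 0).le

namespace LFragment

/-- If the conclusion fails, the Baire property yields an extension `c'` of `c` on which `N`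
generically enters some `S n`. A matching extension `b'` of `b` and the induction hypothesis, used
from `N` to `M`, give the same for `M`, against the hypothesis. -/
theorem eventually_inv_smul_mem {β : Ordinal.{0}} {S : Set (CountableMod L)}
    (hS : @IsBorelSigma _ F.topology (1 + β) S) {M N : CountableMod L} {b c : List ℕ}
    (h : F.iterType M β b = F.iterType N β c)
    (hM : ∀ᶠ g in residual (Equiv.Perm ℕ), g ∈ cylinder b → g⁻¹ • M ∈ Sᶜ) :
    ∀ᶠ g in residual (Equiv.Perm ℕ), g ∈ cylinder c → g⁻¹ • N ∈ Sᶜ := by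
  letI := F.topology
  induction β using WellFoundedLT.induction generalizing S M N b c with
  | _ β ih =>
    generalize hδ : 1 + β = δ at hS
    cases hS with
    | of_isOpen _ hS =>
      -- Iterated types of any level determine the `F`-type, so the value of `β` plays no role here.
      exact Eventually.of_forall fun g hg =>
        forall_inv_smul_mem_of_isClosed hS.isClosed_compl (typeOf_eq_of_iterType_eq h) hM hg
    | iUnion _ ε S hε hS =>
      simp only [Set.compl_iUnion, Set.mem_iInter] at hM ⊢
      simp only [imp_forall_iff, eventually_countable_forall] at hM ⊢
      intro n
      obtain ⟨γ, hγ⟩ : ∃ γ, 1 + γ = ε n := ⟨_, Ordinal.add_sub_cancel_of_le (hS n).one_le⟩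
      have hγβ : γ < β := by
        have := hε n
        rwa [← hγ, ← hδ, add_lt_add_iff_left] at this
      -- The open set `u` agrees, up to a meager set, with the set of `g` for which `g⁻¹ • N ∈ S n`.
      obtain ⟨u, hu, hTu⟩ :=
        (baireMeasurableSet_setOf_inv_smul_mem (hS n) N).of_compl.residualEq_isOpen
      have hTu' : ∀ᶠ g in residual (Equiv.Perm ℕ), g⁻¹ • N ∈ S n ↔ g ∈ u :=
        hTu.mono fun g hg => iff_of_eq hg
      by_contra hcon
      obtain ⟨g, hgu, hg⟩ : (u ∩ cylinder c).Nonempty := by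
        by_contra hemp
        refine hcon (hTu'.mono fun g hg hgc hgS => hemp ⟨g, hg.1 hgS, hgc⟩)
      obtain ⟨c', hcc', hc', hsub⟩ := exists_cylinder_subset hu hgu hg
      obtain ⟨b', hbb', e⟩ :=
        ((iterType_eq_iff_same_level (bot_le.trans_lt hγβ).ne').1 h).2 γ hγβ c' hcc'
      have hb' := nodup_of_typeOf_eq (typeOf_eq_of_iterType_eq e).symm hc'
      have := ih γ hγβ (hγ ▸ hS n) e.symm (by
        filter_upwards [hTu'] with g hg hgc
        rw [compl_compl]
        exact hg.2 (hsub hgc))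
      -- A generic `g` in the cylinder of `b'` puts `g⁻¹ • M` both inside and outside `S n`.
      obtain ⟨g, hg, h₁, h₂⟩ := exists_mem_cylinder (this.and (hM n)) hb'
      exact h₂ (cylinder_subset hbb' hg) (not_not.1 (h₁ hg))

end LFragment

theorem CountableMod.smul_mem_isoClass (g : Equiv.Perm ℕ) (M : CountableMod L) :
    g • M ∈ M.isoClass :=
  ⟨CountableMod.smulEquiv g M⟩

theorem CountableMod.mem_isoClass_of_smul_mem {g : Equiv.Perm ℕ} {M N : CountableMod L}
    (h : g • N ∈ M.isoClass) : N ∈ M.isoClass := by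
  obtain ⟨e⟩ := h
  exact ⟨@FirstOrder.Language.Equiv.comp L ℕ ℕ M (g • N) ℕ N
    (@FirstOrder.Language.Equiv.symm L ℕ ℕ N (g • N) (CountableMod.smulEquiv g N)) e⟩

theorem LFragment.isoClass_eq_setOf_iterTheory_eq {α : Ordinal.{0}} {M : CountableMod L}
    (hM : @IsBorelPi (CountableMod L) F.topology (1 + α) M.isoClass) :
    M.isoClass = {N : CountableMod L | F.iterTheory α N = F.iterTheory α M} := by
  refine Set.Subset.antisymm ?_ fun N hN => ?_
  · rintro N ⟨e⟩
    exact F.iterType_map e α []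
  -- Here `S` is the complement of `[M]`, and the cylinder of the empty list is all of `Sym(ℕ)`.
  · have := eventually_inv_smul_mem hM (show F.iterType M α [] = F.iterType N α [] from hN.symm)
      (Eventually.of_forall fun g _ => by
        rw [compl_compl]
        exact CountableMod.smul_mem_isoClass _ _)
    obtain ⟨g, hg, hgN⟩ := exists_mem_cylinder this List.nodup_nil
    exact CountableMod.mem_isoClass_of_smul_mem (not_not.1 (hgN hg))

end Generic

theorem mainTheorem10 (L : FirstOrder.Language.{u, v}) [Countable L.Symbols] (F : LFragment L)
    (M : CountableMod L) (α : Ordinal.{0}) (hα : α < Ordinal.omega 1) :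
    F.apprClass α M = {N : CountableMod L | F.iterTheory α N = F.iterTheory α M} ∧
    (1 ≤ α → @IsBorelPi (CountableMod L) F.topology (1 + α) M.isoClass →
      M.isoClass = F.apprClass α M) := by
  have h : F.apprClass α M = {N : CountableMod L | F.iterTheory α N = F.iterTheory α M} :=
    Set.ext fun _ => LFragment.apprRel_iff
  exact ⟨h, fun _ hM => (LFragment.isoClass_eq_setOf_iterTheory_eq hM).trans h.symm⟩
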